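/- Let $\mathcal X,\mathcal Y$ be real Hilbert spaces, let $f:\mathcal X\to\mathbb R$ be convex and continuously differentiable with $\ell$-Lipschitz gradient for some $\ell>0$, let $A:\mathcal X\to\mathcal Y$ be a continuous linear operator with adjoint $A^*$, and let $b\in\mathcal Y$. For $\beta\ge 0$ put $$\mathcal L(x,\lambda)=f(x)+\langle\lambda,Ax-b\rangle,\qquad \mathcal L_\beta(x,\lambda)=\mathcal L(x,\lambda)+\tfrac{\beta}{2}\|Ax-b\|^2 .$$ Let $t_0>0$, and let $\delta:[t_0,+\infty)\to(0,+\infty)$ be continuously differentiable and nondecreasing. Suppose that $$\alpha>3,\qquad \beta\ge 0,\qquad \tfrac12>\theta>\tfrac1{\alpha-1},\qquad \sup_{t\ge t_0}\frac{t\,\dot\delta(t)}{\delta(t)}<\frac{1-2\theta}{\theta}.$$ Let $(x,\lambda):[t_0,+\infty)\to\mathcal X\times\mathcal Y$ be a twice continuously differentiable solution of $$\begin{cases}\ddot x(t)+\frac{\alpha}{t}\dot x(t)+\delta(t)\,\nabla_x\mathcal L_\beta\bigl(x(t),\lambda(t)+\theta t\dot\lambda(t)\bigr)=0,\\[2pt]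 \ddot\lambda(t)+\frac{\alpha}{t}\dot\lambda(t)-\delta(t)\,\nabla_\lambda\mathcal L_\beta\bigl(x(t)+\theta t\dot x(t),\lambda(t)\bigr)=0,\end{cases}\qquad t\ge t_0,$$ with arbitrary initial data $(x(t_0),\lambda(t_0))=(x_0,\lambda_0)$ and $(\dot x(t_0),\dot\lambda(t_0))=(\dot x_0,\dot\lambda_0)$ in $\mathcal X\times\mathcal Y$. Let $(x_*,\lambda_*)$ be a saddle point of $\mathcal L$, that is, $\mathcal L(x_*,\lambda)\le\mathcal L(x_*,\lambda_*)\le\mathcal L(x,\lambda_*)$ for all $(x,\lambda)\in\mathcal X\times\mathcal Y$. Then, as $t\to+\infty$, $$\|\nabla f(x(t))-\nabla f(x_*)\|=o\!\left(\frac1{\sqrt t\,\sqrt[4]{\delta(t)}}\right),\qquad \|A^*(\lambda(t)-\lambda_*)\|=o\!\left(\frac1{\sqrt t\,\sqrt[4]{\delta(t)}}\right).$$ Consequently, as $t\to+\infty$, $$\|\nabla_x\mathcal L(x(t),\lambda(t))\|=\|\nabla f(x(t))+A^*\lambda(t)\|=o\!\left(\frac1{\sqrt t\,\sqrt[4]{\delta(t)}}\right),$$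 while $$\|\nabla_\lambda\mathcal L(x(t),\lambda(t))\|=\|Ax(t)-b\|=O\!\left(\frac1{t^2\delta(t)}\right).$$ -/

import Mathlib

open Filter Asymptotics
open scoped NNReal

noncomputable section

namespace PrimalDual

variable {X Y : Type*} [NormedAddCommGroup X] [InnerProductSpace ℝ X] [CompleteSpace X]
  [NormedAddCommGroup Y] [InnerProductSpace ℝ Y] [CompleteSpace Y]

/-- The Lagrangian `L(x, l) = f x + ⟪l, A x - b⟫` of the problem `min f x` subject to `A x = b`. -/
def lagrangian (f : X → ℝ) (A : X →L[ℝ] Y) (b : Y) (x : X) (l : Y) : ℝ :=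
  f x + inner ℝ l (A x - b)

/-- The augmented Lagrangian `L_β(x, l) = L(x, l) + (β / 2) ‖A x - b‖ ^ 2`. -/
def augLagrangian (f : X → ℝ) (A : X →L[ℝ] Y) (b : Y) (β : ℝ) (x : X) (l : Y) : ℝ :=
  lagrangian f A b x l + β / 2 * ‖A x - b‖ ^ 2

/-- The pair `(xs, ls)` is a primal-dual optimal solution, that is, a saddle point of the
Lagrangian: `L(xs, l) ≤ L(xs, ls) ≤ L(x, ls)` for all `x` and `l`. -/
def IsPrimalDualSolution (f : X → ℝ) (A : X →L[ℝ] Y) (b : Y) (xs : X) (ls : Y) : Prop :=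
  ∀ (x : X) (l : Y),
    lagrangian f A b xs l ≤ lagrangian f A b xs ls ∧
      lagrangian f A b xs ls ≤ lagrangian f A b x ls

/-- First derivative on `[t₀, ∞)` (one-sided at `t₀`). -/
def vel {E : Type*} [NormedAddCommGroup E] [NormedSpace ℝ E] (t₀ : ℝ) (x : ℝ → E) : ℝ → E :=
  derivWithin x (Set.Ici t₀)

/-- Second derivative on `[t₀, ∞)` (one-sided at `t₀`). -/
def acc {E : Type*} [NormedAddCommGroup E] [NormedSpace ℝ E] (t₀ : ℝ) (x : ℝ → E) : ℝ → E :=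
  vel t₀ (vel t₀ x)

/-- `(x, l)` is a twice continuously differentiable solution on `[t₀, ∞)` of the time rescaled
primal-dual system with vanishing damping, with initial positions `x₀`, `l₀` and initial
velocities `v₀`, `m₀`. Only the values of `x`, `l` and `δ` on `[t₀, ∞)` matter. -/
structure IsSolution (f : X → ℝ) (A : X →L[ℝ] Y) (b : Y) (α β θ t₀ : ℝ) (δ : ℝ → ℝ)
    (x₀ : X) (l₀ : Y) (v₀ : X) (m₀ : Y) (x : ℝ → X) (l : ℝ → Y) : Prop where
  contDiffOn_x : ContDiffOn ℝ 2 x (Set.Ici t₀)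
  contDiffOn_l : ContDiffOn ℝ 2 l (Set.Ici t₀)
  eq_x : ∀ t, t₀ ≤ t →
    acc t₀ x t + (α / t) • vel t₀ x t +
      δ t • gradient (fun z => augLagrangian f A b β z (l t + (θ * t) • vel t₀ l t)) (x t) = 0
  eq_l : ∀ t, t₀ ≤ t →
    acc t₀ l t + (α / t) • vel t₀ l t -
      δ t • gradient (fun m => augLagrangian f A b β (x t + (θ * t) • vel t₀ x t) m) (l t) = 0
  init_x : x t₀ = x₀
  init_l : l t₀ = l₀
  init_vel_x : vel t₀ x t₀ = v₀
  init_vel_l : vel t₀ l t₀ = m₀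

end PrimalDual

end

/-!
Writing `p = x - xs`, `n = l - ls`, the saddle point conditions `A xs = b` and
`∇f xs = -A* ls` turn the system into one driven by `∇f x - ∇f xs`, `A* n` and `A p`. The energy

`θ² t² δ (L_β(x, ls) - L_β(xs, l)) + (‖p + θ t x'‖² + ‖n + θ t l'‖²) / 2
  + (θ (α - 1) - 1) / 2 * (‖p‖² + ‖n‖²)`

is nonincreasing: the coupling terms cancel (`energy_derivative_identity`), and what remains has a
sign by convexity of `f` and by `θ (2 δ + t δ') ≤ δ`, which is the bound on `t δ' / δ`
(`IsSolution.energy_le`). Hence `p`, `n`, `t x'`, `t l'` and `t² δ (L_β(x, ls) - L_β(xs, l))` are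
bounded (`IsSolution.exists_bound`). Since `f` has Lipschitz gradient, `‖∇f x - ∇f xs‖²` is at most
a constant times the Bregman divergence of `f`, so `‖∇f x - ∇f xs‖ = O(1 / (t √δ))`.

The two other rates come from reading the equations of motion as first-order linear equations.
The function `t l' + (α - 1) n` is bounded and has derivative `t l'' + α l'`, so the dual equation
reads `θ t² δ u' + t δ u = H'` with `u = A x - b` and `H` bounded. Likewise the primal equation reads
`θ t² δ u' + t δ u = H' + t δ r` with `u = A* n`, `H` bounded and `r = O(1 / (t √δ))`. An integrating
factor gives `u = O(1 / (t² δ))` in the first case and `u = O(1 / (t √δ))` in the second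
(`exists_norm_le_of_hasDerivWithinAt`). Finally `1 / (t √δ)` is the square of `1 / (√t δ ^ (1 / 4))`,
which tends to `0`, so every `O(1 / (t √δ))` is `o(1 / (√t δ ^ (1 / 4)))`. No integral estimate along
the trajectory is needed.
-/

/-! ### Convex functions with Lipschitz gradient -/

section Convex

variable {X : Type*} [NormedAddCommGroup X] [InnerProductSpace ℝ X] [CompleteSpace X]

/-- A convex function lies above its tangent planes. -/
theorem ConvexOn.add_inner_gradient_le {f : X → ℝ} (hf : ConvexOn ℝ Set.univ f) {x : X}
    (hd : DifferentiableAt ℝ f x) (y : X) :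
    f x + inner ℝ (gradient f x) (y - x) ≤ f y := by
  have hline : HasDerivAt (fun s : ℝ => AffineMap.lineMap x y s) (y - x) 0 :=
    AffineMap.hasDerivAt_lineMap
  have hfd : HasFDerivAt f (InnerProductSpace.toDual ℝ X (gradient f x))
      (AffineMap.lineMap x y (0 : ℝ)) := by
    simpa using hd.hasGradientAt.hasFDerivAt
  have hder := hfd.comp_hasDerivAt (0 : ℝ) hline
  have hslope := (hf.comp_affineMap (AffineMap.lineMap x y)).le_slope_of_hasDerivAt
    (Set.mem_univ (0 : ℝ)) (Set.mem_univ (1 : ℝ)) one_pos hder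
  simp only [slope_def_field, Function.comp, AffineMap.lineMap_apply_zero,
    AffineMap.lineMap_apply_one, InnerProductSpace.toDual_apply_apply] at hslope
  linarith

/-- The gradient gap is controlled by the Bregman divergence: compare `f` at the gradient step
`z = x - (∇f x - ∇f y) / (2 ℓ)` with the tangent planes at `y` and at `z`. -/
theorem ConvexOn.norm_sub_gradient_sq_le {f : X → ℝ} (hf : ConvexOn ℝ Set.univ f)
    (hd : Differentiable ℝ f) {ℓ : ℝ≥0} (hℓ : 0 < ℓ) (hlip : LipschitzWith ℓ (gradient f))
    (x y : X) :
    ‖gradient f x - gradient f y‖ ^ 2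
      ≤ 4 * ℓ * (f x - f y - inner ℝ (gradient f y) (x - y)) := by
  have hℓ' : (0 : ℝ) < ℓ := hℓ
  set d := gradient f x - gradient f y with hd_def
  set s : ℝ := 1 / (2 * ℓ) with hs
  have hs0 : 0 < s := by positivity
  set z := x - s • d with hz
  have h1 := hf.add_inner_gradient_le (hd z) x
  have h2 := hf.add_inner_gradient_le (hd y) z
  have hxz : x - z = s • d := by simp [hz]
  have hzy : z - y = (x - y) - s • d := by rw [hz]; abel
  rw [hxz, inner_smul_right] at h1
  rw [hzy, inner_sub_right, inner_smul_right] at h2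
  have h3 : inner ℝ (gradient f z) d - inner ℝ (gradient f y) d
      = ‖d‖ ^ 2 - inner ℝ (gradient f x - gradient f z) d := by
    rw [← real_inner_self_eq_norm_sq, ← inner_sub_left, ← inner_sub_left]
    congr 1
    rw [hd_def]; abel
  have h4 : inner ℝ (gradient f x - gradient f z) d ≤ ℓ * s * ‖d‖ ^ 2 := by
    refine (real_inner_le_norm _ _).trans ?_
    have h5 := hlip.norm_sub_le x z
    rw [hxz, norm_smul, Real.norm_of_nonneg hs0.le] at h5
    nlinarith [norm_nonneg d]
  have h6 : ℓ * s = 1 / 2 := by rw [hs]; field_simp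
  rw [h6] at h4
  have h7 : s * (‖d‖ ^ 2 / 2) ≤ f x - f y - inner ℝ (gradient f y) (x - y) := by
    have : s * (‖d‖ ^ 2 / 2) ≤ s * (inner ℝ (gradient f z) d - inner ℝ (gradient f y) d) :=
      mul_le_mul_of_nonneg_left (by linarith) hs0.le
    linarith
  calc ‖d‖ ^ 2 = 4 * ℓ * (s * (‖d‖ ^ 2 / 2)) := by
        linear_combination (-2 * ‖d‖ ^ 2) * h6
    _ ≤ _ := by gcongr

end Convex

/-! ### Gradients of the Lagrangians and the saddle point conditions -/

namespace PrimalDual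

/-- The primal component of a saddle point is feasible. -/
theorem IsPrimalDualSolution.map_eq {X Y : Type*}
    [NormedAddCommGroup X] [InnerProductSpace ℝ X] [NormedAddCommGroup Y] [InnerProductSpace ℝ Y]
    {f : X → ℝ} {A : X →L[ℝ] Y} {b : Y} {xs : X} {ls : Y}
    (h : IsPrimalDualSolution f A b xs ls) : A xs = b := by
  have h1 := (h xs (ls + (A xs - b))).1
  simp only [lagrangian, inner_add_left, real_inner_self_eq_norm_sq] at h1
  have h2 : ‖A xs - b‖ ^ 2 = 0 := le_antisymm (by linarith) (sq_nonneg _)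
  simpa [sub_eq_zero] using h2

theorem gradient_augLagrangian_right {X Y : Type*}
    [NormedAddCommGroup X] [InnerProductSpace ℝ X]
    [NormedAddCommGroup Y] [InnerProductSpace ℝ Y] [CompleteSpace Y]
    {f : X → ℝ} (A : X →L[ℝ] Y) (b : Y) (β : ℝ) (x : X) (l : Y) :
    gradient (fun m => augLagrangian f A b β x m) l = A x - b := by
  refine HasGradientAt.gradient ?_
  rw [hasGradientAt_iff_hasFDerivAt]
  have h := (((hasFDerivAt_id l).inner ℝ (hasFDerivAt_const (A x - b) l)).const_add
    (f x)).add_const (β / 2 * ‖A x - b‖ ^ 2)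
  refine h.congr_fderiv ?_
  ext v
  simp [inner_sub_right, real_inner_comm]

theorem gradient_lagrangian_right {X Y : Type*}
    [NormedAddCommGroup X] [InnerProductSpace ℝ X]
    [NormedAddCommGroup Y] [InnerProductSpace ℝ Y] [CompleteSpace Y]
    {f : X → ℝ} (A : X →L[ℝ] Y) (b : Y) (x : X) (l : Y) :
    gradient (fun m => lagrangian f A b x m) l = A x - b := by
  simpa [augLagrangian] using gradient_augLagrangian_right (f := f) A b 0 x l

section Gradients

variable {X Y : Type*} [NormedAddCommGroup X] [InnerProductSpace ℝ X] [CompleteSpace X]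
  [NormedAddCommGroup Y] [InnerProductSpace ℝ Y] [CompleteSpace Y]
  {f : X → ℝ} (A : X →L[ℝ] Y) (b : Y)

theorem hasGradientAt_augLagrangian_left (β : ℝ) (l : Y) {x : X} (hf : DifferentiableAt ℝ f x) :
    HasGradientAt (fun z => augLagrangian f A b β z l)
      (gradient f x + A.adjoint l + β • A.adjoint (A x - b)) x := by
  have hA : HasFDerivAt (fun z => A z - b) A x := A.hasFDerivAt.sub_const b
  have h := (hf.hasGradientAt.hasFDerivAt.add ((hasFDerivAt_const l x).inner ℝ hA)).add
    (hA.norm_sq.const_mul (β / 2))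
  rw [hasGradientAt_iff_hasFDerivAt]
  refine h.congr_fderiv ?_
  ext v
  simp [ContinuousLinearMap.adjoint_inner_left]
  ring

theorem gradient_augLagrangian_left (β : ℝ) (l : Y) {x : X} (hf : DifferentiableAt ℝ f x) :
    gradient (fun z => augLagrangian f A b β z l) x
      = gradient f x + A.adjoint l + β • A.adjoint (A x - b) :=
  (hasGradientAt_augLagrangian_left A b β l hf).gradient

theorem gradient_lagrangian_left (l : Y) {x : X} (hf : DifferentiableAt ℝ f x) :
    gradient (fun z => lagrangian f A b z l) x = gradient f x + A.adjoint l := by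
  simpa [augLagrangian] using gradient_augLagrangian_left A b 0 l hf

variable {A b} {xs : X} {ls : Y}

/-- The primal component of a saddle point is stationary for the Lagrangian. -/
theorem IsPrimalDualSolution.gradient_eq (h : IsPrimalDualSolution f A b xs ls)
    (hf : DifferentiableAt ℝ f xs) : gradient f xs = -A.adjoint ls := by
  have hmin : IsLocalMin (fun z => augLagrangian f A b 0 z ls) xs :=
    Filter.Eventually.of_forall fun z => by simpa [augLagrangian] using (h z ls).2
  have h0 := hmin.hasFDerivAt_eq_zero (hasGradientAt_augLagrangian_left A b 0 ls hf).hasFDerivAt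
  rw [LinearIsometryEquiv.map_eq_zero_iff, zero_smul, add_zero] at h0
  exact eq_neg_of_add_eq_zero_left h0

end Gradients

end PrimalDual

/-! ### Decay of solutions of a first-order linear equation -/

/-- Multiplying the equation by `p t = t ^ (1 / θ - 2) / δ t` turns it into
`(θ t ^ (1 / θ) u - p H)' = p t δ r - p' H`. As `p` is nondecreasing and `H` is bounded, the
right-hand side is dominated by the derivative of a combination of `p` and
`t ^ (1 / θ - 1) / √δ`. -/
theorem exists_norm_le_of_hasDerivWithinAt {E : Type*} [NormedAddCommGroup E] [NormedSpace ℝ E]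
    {t₀ θ M C : ℝ} (ht₀ : 0 < t₀) (hθ : 0 < θ) (hC : 0 ≤ C) {δ dδ : ℝ → ℝ}
    (hδ : ∀ t, t₀ ≤ t → HasDerivWithinAt δ (dδ t) (Set.Ici t₀) t)
    (hδ_pos : ∀ t, t₀ ≤ t → 0 < δ t)
    (hδ_le : ∀ t, t₀ ≤ t → θ * (2 * δ t + t * dδ t) ≤ δ t)
    {u du H dH r : ℝ → E}
    (hu : ∀ t, t₀ ≤ t → HasDerivWithinAt u (du t) (Set.Ici t₀) t)
    (hH : ∀ t, t₀ ≤ t → HasDerivWithinAt H (dH t) (Set.Ici t₀) t)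
    (heq : ∀ t, t₀ ≤ t →
      (θ * t ^ 2 * δ t) • du t + (t * δ t) • u t = dH t + (t * δ t) • r t)
    (hM : ∀ t, t₀ ≤ t → ‖H t‖ ≤ M)
    (hr : ∀ t, t₀ ≤ t → ‖r t‖ ≤ C / (t * √(δ t))) :
    ∃ K, 0 ≤ K ∧ ∀ t, t₀ ≤ t → ‖u t‖ ≤ K / (t ^ 2 * δ t) + 2 * C / (t * √(δ t)) := by
  set a : ℝ := 1 / θ with ha
  have haθ : a * θ = 1 := by rw [ha]; field_simp
  set p : ℝ → ℝ := fun t => t ^ (a - 2) / δ t with hp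
  set q : ℝ → ℝ := fun t => t ^ (a - 1) / √(δ t) with hq
  set dp : ℝ → ℝ := fun t => t ^ (a - 3) * ((a - 2) * δ t - t * dδ t) / δ t ^ 2 with hdp
  set dq : ℝ → ℝ := fun t =>
    t ^ (a - 2) * ((a - 1) * δ t - t * dδ t / 2) / (δ t * √(δ t)) with hdq
  set F : ℝ → E := fun t => (θ * t ^ a) • u t - p t • H t with hF
  have hM0 : 0 ≤ M := (norm_nonneg _).trans (hM t₀ le_rfl)
  have hp_pos : ∀ t, t₀ ≤ t → 0 < p t := fun t ht =>
    div_pos (Real.rpow_pos_of_pos (ht₀.trans_le ht) _) (hδ_pos t ht)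
  have hpow1 : ∀ t, t₀ ≤ t → t ^ (a - 2) = t * t ^ (a - 3) := fun t ht => by
    have := Real.rpow_add_one (ht₀.trans_le ht).ne' (a - 3)
    rw [show a - 3 + 1 = a - 2 by ring] at this
    rw [this, mul_comm]
  have hpow2 : ∀ t, t₀ ≤ t → t ^ (a - 1) = t * t ^ (a - 2) := fun t ht => by
    have := Real.rpow_add_one (ht₀.trans_le ht).ne' (a - 2)
    rw [show a - 2 + 1 = a - 1 by ring] at this
    rw [this, mul_comm]
  have hpow3 : ∀ t, t₀ ≤ t → t ^ a = t ^ 2 * t ^ (a - 2) := fun t ht => by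
    have := Real.rpow_add_one (ht₀.trans_le ht).ne' (a - 1)
    rw [show a - 1 + 1 = a by ring] at this
    rw [this, hpow2 t ht]; ring
  have hpd : ∀ t, t₀ ≤ t → HasDerivWithinAt p (dp t) (Set.Ici t₀) t := fun t ht => by
    have hδt := hδ_pos t ht
    have h := (((hasDerivWithinAt_id t (Set.Ici t₀)).rpow_const (p := a - 2)
      (Or.inl (ht₀.trans_le ht).ne')).fun_div (hδ t ht) hδt.ne')
    refine h.congr_deriv ?_
    simp only [hdp, id, show a - 2 - 1 = a - 3 by ring, hpow1 t ht]
    ring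
  have hqd : ∀ t, t₀ ≤ t → HasDerivWithinAt q (dq t) (Set.Ici t₀) t := fun t ht => by
    have hδt := hδ_pos t ht
    have hs : 0 < √(δ t) := Real.sqrt_pos.2 hδt
    have hss : √(δ t) ^ 2 = δ t := Real.sq_sqrt hδt.le
    have h := (((hasDerivWithinAt_id t (Set.Ici t₀)).rpow_const (p := a - 1)
      (Or.inl (ht₀.trans_le ht).ne')).fun_div ((hδ t ht).sqrt hδt.ne') hs.ne')
    refine h.congr_deriv ?_
    simp only [hdq, id, show a - 1 - 1 = a - 2 by ring, hpow2 t ht]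
    rw [hss]
    field_simp
    rw [hss]
  have hFd : ∀ t, t₀ ≤ t → HasDerivWithinAt F ((p t * (t * δ t)) • r t - dp t • H t)
      (Set.Ici t₀) t := fun t ht => by
    have hδt := hδ_pos t ht
    have h := ((((hasDerivWithinAt_id t (Set.Ici t₀)).rpow_const (p := a)
      (Or.inl (ht₀.trans_le ht).ne')).const_mul θ).fun_smul (hu t ht)).fun_sub
      ((hpd t ht).fun_smul (hH t ht))
    refine h.congr_deriv ?_
    have e1 : θ * t ^ a = p t * (θ * t ^ 2 * δ t) := by
      rw [hpow3 t ht, hp]; field_simp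
    have e2 : θ * (1 * a * t ^ (a - 1)) = p t * (t * δ t) := by
      rw [hpow2 t ht, hp]; field_simp; linear_combination (t * t ^ (a - 2)) * haθ
    have e3 : dH t = (θ * t ^ 2 * δ t) • du t + (t * δ t) • u t - (t * δ t) • r t := by
      rw [heq t ht]; abel
    simp only [id]
    rw [e1, e2, e3]
    module
  -- The coefficient of `p` exceeds `M` so that the bound also dominates the initial value.
  set K₀ : ℝ := ‖F t₀‖ / p t₀ + M with hK₀
  have hdp_nonneg : ∀ t, t₀ ≤ t → 0 ≤ dp t := fun t ht => by
    have hδt := hδ_pos t ht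
    have : 0 ≤ (a - 2) * δ t - t * dδ t := by
      have h1 := mul_le_mul_of_nonneg_left (hδ_le t ht) (by positivity : 0 ≤ a)
      have h2 : a * (θ * (2 * δ t + t * dδ t)) = 2 * δ t + t * dδ t := by
        rw [← mul_assoc, haθ, one_mul]
      linarith
    exact div_nonneg (mul_nonneg (Real.rpow_nonneg (ht₀.trans_le ht).le _) this) (sq_nonneg _)
  have hbound : ∀ t, t₀ ≤ t →
      ‖(p t * (t * δ t)) • r t - dp t • H t‖ ≤ K₀ * dp t + 2 * θ * C * dq t := fun t ht => by
    have hδt := hδ_pos t ht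
    have ht' := ht₀.trans_le ht
    have hs : 0 < √(δ t) := Real.sqrt_pos.2 hδt
    have h1 : ‖dp t • H t‖ ≤ K₀ * dp t := by
      rw [norm_smul, Real.norm_of_nonneg (hdp_nonneg t ht), mul_comm]
      refine mul_le_mul_of_nonneg_right ((hM t ht).trans ?_) (hdp_nonneg t ht)
      have := div_nonneg (norm_nonneg (F t₀)) (hp_pos t₀ le_rfl).le
      linarith
    have h2 : ‖(p t * (t * δ t)) • r t‖ ≤ C * (t ^ (a - 2) / √(δ t)) := by
      have hc : 0 ≤ p t * (t * δ t) := by have := hp_pos t ht; positivity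
      rw [norm_smul, Real.norm_of_nonneg hc]
      refine (mul_le_mul_of_nonneg_left (hr t ht) hc).trans_eq ?_
      rw [hp]; field_simp
    have h3 : t ^ (a - 2) / √(δ t) ≤ 2 * θ * dq t := by
      have h4 : 2 * θ * dq t - t ^ (a - 2) / √(δ t)
          = t ^ (a - 2) / (δ t * √(δ t)) * (δ t - θ * (2 * δ t + t * dδ t)) := by
        simp only [hdq]
        field_simp
        linear_combination (2 * δ t) * haθ
      have h5 : 0 ≤ t ^ (a - 2) / (δ t * √(δ t)) * (δ t - θ * (2 * δ t + t * dδ t)) :=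
        mul_nonneg (by positivity) (sub_nonneg.2 (hδ_le t ht))
      linarith
    calc ‖(p t * (t * δ t)) • r t - dp t • H t‖
        ≤ C * (t ^ (a - 2) / √(δ t)) + K₀ * dp t := (norm_sub_le _ _).trans (add_le_add h2 h1)
      _ ≤ C * (2 * θ * dq t) + K₀ * dp t := by gcongr
      _ = _ := by ring
  have hBd : ∀ t, t₀ ≤ t → HasDerivWithinAt (fun t => K₀ * p t + 2 * θ * C * q t)
      (K₀ * dp t + 2 * θ * C * dq t) (Set.Ici t₀) t := fun t ht =>
    ((hpd t ht).const_mul K₀).fun_add ((hqd t ht).const_mul (2 * θ * C))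
  have hq_nonneg : ∀ t, t₀ ≤ t → 0 ≤ q t := fun t ht =>
    div_nonneg (Real.rpow_nonneg (ht₀.trans_le ht).le _) (Real.sqrt_nonneg _)
  have hinit : ‖F t₀‖ ≤ K₀ * p t₀ + 2 * θ * C * q t₀ := by
    have h1 : K₀ * p t₀ = ‖F t₀‖ + M * p t₀ := by
      have := (hp_pos t₀ le_rfl).ne'
      rw [hK₀]; field_simp
    have h2 := mul_nonneg hM0 (hp_pos t₀ le_rfl).le
    have h3 := mul_nonneg (by positivity : 0 ≤ 2 * θ * C) (hq_nonneg t₀ le_rfl)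
    linarith
  have hFB : ∀ t, t₀ ≤ t → ‖F t‖ ≤ K₀ * p t + 2 * θ * C * q t := fun t ht =>
    image_norm_le_of_norm_deriv_right_le_deriv_boundary' (a := t₀) (b := t)
      (fun s hs => ((hFd s hs.1).continuousWithinAt).mono Set.Icc_subset_Ici_self)
      (fun s hs => (hFd s hs.1).mono (Set.Ici_subset_Ici.2 hs.1)) hinit
      (fun s hs => ((hBd s hs.1).continuousWithinAt).mono Set.Icc_subset_Ici_self)
      (fun s hs => (hBd s hs.1).mono (Set.Ici_subset_Ici.2 hs.1))
      (fun s hs => hbound s hs.1) ⟨ht, le_rfl⟩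
  have hK₀0 : 0 ≤ K₀ := by
    have := (hp_pos t₀ le_rfl).le
    positivity
  refine ⟨(K₀ + M) / θ, by positivity, fun t ht => ?_⟩
  have hδt := hδ_pos t ht
  have ht' := ht₀.trans_le ht
  have hs : 0 < √(δ t) := Real.sqrt_pos.2 hδt
  have hta : 0 < t ^ (a - 2) := Real.rpow_pos_of_pos ht' _
  have h1 : θ * t ^ a * ‖u t‖ ≤ (K₀ + M) * p t + 2 * θ * C * q t := by
    have e1 : (θ * t ^ a) • u t = F t + p t • H t := by rw [hF]; simp
    have e2 : ‖p t • H t‖ ≤ M * p t := by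
      rw [norm_smul, Real.norm_of_nonneg (hp_pos t ht).le, mul_comm]
      exact mul_le_mul_of_nonneg_right (hM t ht) (hp_pos t ht).le
    have e3 : ‖(θ * t ^ a) • u t‖ = θ * t ^ a * ‖u t‖ := by
      rw [norm_smul, Real.norm_of_nonneg (by positivity)]
    rw [← e3, e1]
    have := norm_add_le (F t) (p t • H t)
    linarith [hFB t ht]
  have h2 : θ * t ^ a * ((K₀ + M) / θ / (t ^ 2 * δ t) + 2 * C / (t * √(δ t)))
      = (K₀ + M) * p t + 2 * θ * C * q t := by
    simp only [hp, hq]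
    rw [hpow3 t ht, hpow2 t ht]
    field_simp
  exact le_of_mul_le_mul_left (h1.trans_eq h2.symm) (by positivity)

/-! ### Trajectories and their energy -/

theorem ContDiffOn.hasDerivWithinAt_vel {E : Type*} [NormedAddCommGroup E] [NormedSpace ℝ E]
    {t₀ : ℝ} {x : ℝ → E} (hx : ContDiffOn ℝ 2 x (Set.Ici t₀)) {t : ℝ} (ht : t₀ ≤ t) :
    HasDerivWithinAt x (PrimalDual.vel t₀ x t) (Set.Ici t₀) t :=
  (hx.differentiableOn two_ne_zero t ht).hasDerivWithinAt

theorem ContDiffOn.hasDerivWithinAt_acc {E : Type*} [NormedAddCommGroup E] [NormedSpace ℝ E]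
    {t₀ : ℝ} {x : ℝ → E} (hx : ContDiffOn ℝ 2 x (Set.Ici t₀)) {t : ℝ} (ht : t₀ ≤ t) :
    HasDerivWithinAt (PrimalDual.vel t₀ x) (PrimalDual.acc t₀ x t) (Set.Ici t₀) t :=
  ((hx.derivWithin (m := 1) (uniqueDiffOn_Ici t₀) (by norm_num)).differentiableOn
    one_ne_zero t ht).hasDerivWithinAt

namespace PrimalDual

/-- The gap `L_β(x, ls) - L_β(xs, l)`, written for a saddle point `(xs, ls)` as the Bregman
divergence of `f` between `x` and `xs` plus the penalty term; then it does not depend on `l`. -/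
noncomputable def gap {X Y : Type*} [NormedAddCommGroup X] [InnerProductSpace ℝ X]
    [CompleteSpace X] [NormedAddCommGroup Y] [InnerProductSpace ℝ Y] (f : X → ℝ) (A : X →L[ℝ] Y) (β : ℝ)
    (xs x : X) : ℝ :=
  f x - f xs - inner ℝ (gradient f xs) (x - xs) + β / 2 * ‖A (x - xs)‖ ^ 2

theorem gap_nonneg {X Y : Type*} [NormedAddCommGroup X] [InnerProductSpace ℝ X] [CompleteSpace X]
    [NormedAddCommGroup Y] [InnerProductSpace ℝ Y] {f : X → ℝ} {A : X →L[ℝ] Y} {β : ℝ}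
    (hf : Differentiable ℝ f) (hconv : ConvexOn ℝ Set.univ f) (hβ : 0 ≤ β)
    (xs x : X) : 0 ≤ gap f A β xs x := by
  have h1 := hconv.add_inner_gradient_le (hf xs) x
  have h2 : 0 ≤ β * ‖A (x - xs)‖ ^ 2 := by positivity
  rw [gap]; linarith

variable {X Y : Type*} [NormedAddCommGroup X] [InnerProductSpace ℝ X] [CompleteSpace X]
  [NormedAddCommGroup Y] [InnerProductSpace ℝ Y] [CompleteSpace Y]

/-- The Lyapunov function of the system at time `t`, in terms of the positions `x`, `l` and the
velocities `v`, `m`. -/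
noncomputable def energy (f : X → ℝ) (A : X →L[ℝ] Y) (α β θ : ℝ) (xs : X) (ls : Y)
    (d t : ℝ) (x v : X) (l m : Y) : ℝ :=
  θ ^ 2 * t ^ 2 * d * gap f A β xs x
    + (‖x - xs + (θ * t) • v‖ ^ 2 + ‖l - ls + (θ * t) • m‖ ^ 2) / 2
    + (θ * (α - 1) - 1) / 2 * (‖x - xs‖ ^ 2 + ‖l - ls‖ ^ 2)

/-- Along the trajectory the coupling terms between the primal and the dual variables cancel. Here
`p = x - xs`, `n = l - ls`, `e = ∇f x - ∇f xs`, while `v`, `m` are the velocities and `w`, `k` the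
derivatives of `p + θ t v` and `n + θ t m`. -/
theorem energy_derivative_identity (A : X →L[ℝ] Y) (β θ t d dd G ξ : ℝ)
    (p v e w : X) (n m k : Y)
    (hw : w = -ξ • v - (θ * t * d) • (e + A.adjoint (n + (θ * t) • m) + β • A.adjoint (A p)))
    (hk : k = -ξ • m + (θ * t * d) • A (p + (θ * t) • v)) :
    θ ^ 2 * (2 * t * d + t ^ 2 * dd) * G
        + θ ^ 2 * t ^ 2 * d * (inner ℝ e v + β * inner ℝ (A p) (A v))
        + (inner ℝ (p + (θ * t) • v) w + inner ℝ (n + (θ * t) • m) k)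
        + ξ * (inner ℝ p v + inner ℝ n m)
      = θ * t * (θ * (2 * d + t * dd) * G - d * (inner ℝ e p + β * ‖A p‖ ^ 2))
        - ξ * θ * t * (‖v‖ ^ 2 + ‖m‖ ^ 2) := by
  subst hw hk
  simp only [inner_add_left, inner_add_right, inner_sub_right, real_inner_smul_left,
    real_inner_smul_right, ContinuousLinearMap.adjoint_inner_right, map_add, map_smul,
    ← real_inner_self_eq_norm_sq]
  rw [real_inner_comm v e, real_inner_comm p e, real_inner_comm (A v) (A p),
    real_inner_comm (A p) n, real_inner_comm (A v) n, real_inner_comm (A p) m,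
    real_inner_comm (A v) m]
  ring

variable {f : X → ℝ} {A : X →L[ℝ] Y} {b : Y} {α β θ t₀ : ℝ} {δ : ℝ → ℝ}
  {x₀ v₀ : X} {l₀ m₀ : Y} {x : ℝ → X} {l : ℝ → Y} {xs : X} {ls : Y}

/-- The primal equation of motion, with the forces measured relative to a saddle point. -/
theorem IsSolution.acc_primal_eq (hsol : IsSolution f A b α β θ t₀ δ x₀ l₀ v₀ m₀ x l)
    (hf : Differentiable ℝ f) (hopt : IsPrimalDualSolution f A b xs ls) {t : ℝ} (ht : t₀ ≤ t) :
    acc t₀ x t = -(α / t) • vel t₀ x t - δ t • (gradient f (x t) - gradient f xs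
      + A.adjoint (l t - ls + (θ * t) • vel t₀ l t) + β • A.adjoint (A (x t - xs))) := by
  have h := hsol.eq_x t ht
  rw [gradient_augLagrangian_left A b β _ (hf (x t))] at h
  rw [hopt.gradient_eq (hf xs), map_sub A, hopt.map_eq]
  simp only [map_add, map_sub] at h ⊢
  rw [← sub_eq_zero, ← h]
  module

/-- The dual equation of motion, with the constraint residual measured relative to a saddle
point. -/
theorem IsSolution.acc_dual_eq (hsol : IsSolution f A b α β θ t₀ δ x₀ l₀ v₀ m₀ x l)
    (hopt : IsPrimalDualSolution f A b xs ls) {t : ℝ} (ht : t₀ ≤ t) :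
    acc t₀ l t = -(α / t) • vel t₀ l t + δ t • A (x t - xs + (θ * t) • vel t₀ x t) := by
  have h := hsol.eq_l t ht
  rw [gradient_augLagrangian_right] at h
  simp only [map_add, map_sub, hopt.map_eq] at h ⊢
  rw [← sub_eq_zero, ← h]
  module

/-- The energy does not increase along a trajectory. -/
theorem IsSolution.energy_le (hsol : IsSolution f A b α β θ t₀ δ x₀ l₀ v₀ m₀ x l)
    (hf : Differentiable ℝ f) (hconv : ConvexOn ℝ Set.univ f)
    (hopt : IsPrimalDualSolution f A b xs ls)
    (ht₀ : 0 < t₀) (hβ : 0 ≤ β) (hθ : 0 < θ) (hξ : 0 ≤ θ * (α - 1) - 1) {dδ : ℝ → ℝ}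
    (hδ : ∀ t, t₀ ≤ t → HasDerivWithinAt δ (dδ t) (Set.Ici t₀) t)
    (hδ_pos : ∀ t, t₀ ≤ t → 0 < δ t)
    (hδ_le : ∀ t, t₀ ≤ t → θ * (2 * δ t + t * dδ t) ≤ δ t) {t : ℝ} (ht : t₀ ≤ t) :
    energy f A α β θ xs ls (δ t) t (x t) (vel t₀ x t) (l t) (vel t₀ l t)
      ≤ energy f A α β θ xs ls (δ t₀) t₀ (x t₀) (vel t₀ x t₀) (l t₀) (vel t₀ l t₀) := by
  set ξ := θ * (α - 1) - 1 with hξ_def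
  set E : ℝ → ℝ := fun t =>
    energy f A α β θ xs ls (δ t) t (x t) (vel t₀ x t) (l t) (vel t₀ l t) with hE
  have key : ∀ s, t₀ ≤ s → ∃ E', E' ≤ 0 ∧ HasDerivWithinAt E E' (Set.Ici t₀) s := by
    intro s hs
    have hs0 : 0 < s := ht₀.trans_le hs
    have hx := hsol.contDiffOn_x.hasDerivWithinAt_vel hs
    have hl := hsol.contDiffOn_l.hasDerivWithinAt_vel hs
    have hvx := hsol.contDiffOn_x.hasDerivWithinAt_acc hs
    have hvl := hsol.contDiffOn_l.hasDerivWithinAt_acc hs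
    have hid := hasDerivWithinAt_id s (Set.Ici t₀)
    have hp := hx.sub_const xs
    have hn := hl.sub_const ls
    have hP := hp.fun_add ((hid.const_mul θ).fun_smul hvx)
    have hN := hn.fun_add ((hid.const_mul θ).fun_smul hvl)
    have hfx := (hf (x s)).hasGradientAt.hasFDerivAt.comp_hasDerivWithinAt s hx
    have hgx := (hasDerivWithinAt_const s (Set.Ici t₀) (gradient f xs)).inner ℝ hp
    have hAx := (A.hasFDerivAt.comp_hasDerivWithinAt s hp).norm_sq
    have hG : HasDerivWithinAt (fun s => gap f A β xs (x s))
        (inner ℝ (gradient f (x s) - gradient f xs) (vel t₀ x s)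
          + β * inner ℝ (A (x s - xs)) (A (vel t₀ x s))) (Set.Ici t₀) s := by
      refine (((hfx.sub_const (f xs)).sub hgx).add (hAx.const_mul (β / 2))).congr_deriv ?_
      simp [inner_sub_left]
      ring
    have hd := (((hid.fun_pow 2).const_mul (θ ^ 2)).fun_mul (hδ s hs)).fun_mul hG
    have hEd := (hd.fun_add ((hP.norm_sq.fun_add hN.norm_sq).div_const 2)).fun_add
      ((hp.norm_sq.fun_add hn.norm_sq).const_mul (ξ / 2))
    have hiden := energy_derivative_identity A β θ s (δ s) (dδ s) (gap f A β xs (x s)) ξ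
      (x s - xs) (vel t₀ x s) (gradient f (x s) - gradient f xs)
      (vel t₀ x s + ((θ * s) • acc t₀ x s + θ • vel t₀ x s))
      (l s - ls) (vel t₀ l s)
      (vel t₀ l s + ((θ * s) • acc t₀ l s + θ • vel t₀ l s))
      (by
        rw [hsol.acc_primal_eq hf hopt hs, hξ_def, smul_sub, smul_smul, smul_smul,
          show θ * s * -(α / s) = -(θ * α) by field_simp]
        module)
      (by
        rw [hsol.acc_dual_eq hopt hs, hξ_def, smul_add, smul_smul, smul_smul,
          show θ * s * -(α / s) = -(θ * α) by field_simp]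
        module)
    refine ⟨_, ?_, hEd.congr_deriv (Eq.trans ?_ hiden)⟩
    · have hbreg := hconv.add_inner_gradient_le (hf xs) (x s)
      have hmono := hconv.add_inner_gradient_le (hf (x s)) xs
      rw [← neg_sub (x s) xs, inner_neg_right] at hmono
      have hY : 0 ≤ β * ‖A (x s - xs)‖ ^ 2 := by positivity
      have hGe : gap f A β xs (x s) ≤ inner ℝ (gradient f (x s) - gradient f xs) (x s - xs)
          + β * ‖A (x s - xs)‖ ^ 2 := by
        rw [gap, inner_sub_left]; linarith
      have hG0 := gap_nonneg (A := A) hf hconv hβ xs (x s)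
      have h1 := mul_le_mul_of_nonneg_right (hδ_le s hs) hG0
      have h2 := mul_le_mul_of_nonneg_left hGe (hδ_pos s hs).le
      have h3 : 0 ≤ ξ * θ * s * (‖vel t₀ x s‖ ^ 2 + ‖vel t₀ l s‖ ^ 2) := by positivity
      have h4 := mul_nonneg (mul_pos hθ hs0).le (sub_nonneg.2 (h1.trans h2))
      linarith
    · simp only [id, mul_one]
      ring
  choose! E' hE'0 hE' using key
  exact image_le_of_deriv_right_le_deriv_boundary (a := t₀) (b := t) (B := fun _ => E t₀)
    (B' := fun _ => 0)
    (fun s hs => ((hE' s hs.1).continuousWithinAt).mono Set.Icc_subset_Ici_self)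
    (fun s hs => (hE' s hs.1).mono (Set.Ici_subset_Ici.2 hs.1)) le_rfl continuousOn_const
    (fun s _ => hasDerivWithinAt_const _ _ _) (fun s hs => hE'0 s hs.1) ⟨ht, le_rfl⟩

end PrimalDual

/-! ### Boundedness and convergence rates -/

namespace PrimalDual

variable {X Y : Type*} [NormedAddCommGroup X] [InnerProductSpace ℝ X] [CompleteSpace X]
  [NormedAddCommGroup Y] [InnerProductSpace ℝ Y] [CompleteSpace Y]
  {f : X → ℝ} {A : X →L[ℝ] Y} {b : Y} {α β θ t₀ : ℝ} {δ : ℝ → ℝ}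
  {x₀ v₀ : X} {l₀ m₀ : Y} {x : ℝ → X} {l : ℝ → Y} {xs : X} {ls : Y}

/-- As the energy is bounded by its initial value, so is each of its nonnegative terms. -/
theorem IsSolution.exists_bound (hsol : IsSolution f A b α β θ t₀ δ x₀ l₀ v₀ m₀ x l)
    (hf : Differentiable ℝ f) (hconv : ConvexOn ℝ Set.univ f)
    (hopt : IsPrimalDualSolution f A b xs ls)
    (ht₀ : 0 < t₀) (hβ : 0 ≤ β) (hθ : 0 < θ) (hξ : 0 < θ * (α - 1) - 1) {dδ : ℝ → ℝ}
    (hδ : ∀ t, t₀ ≤ t → HasDerivWithinAt δ (dδ t) (Set.Ici t₀) t)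
    (hδ_pos : ∀ t, t₀ ≤ t → 0 < δ t)
    (hδ_le : ∀ t, t₀ ≤ t → θ * (2 * δ t + t * dδ t) ≤ δ t) :
    ∃ R, 0 ≤ R ∧ ∀ t, t₀ ≤ t →
      ‖x t - xs‖ ≤ R ∧ ‖l t - ls‖ ≤ R ∧
      ‖x t - xs + (θ * t) • vel t₀ x t‖ ≤ R ∧ ‖l t - ls + (θ * t) • vel t₀ l t‖ ≤ R ∧
      t ^ 2 * δ t * gap f A β xs (x t) ≤ R ^ 2 := by
  set ξ := θ * (α - 1) - 1 with hξ_def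
  set E₀ := energy f A α β θ xs ls (δ t₀) t₀ (x t₀) (vel t₀ x t₀) (l t₀) (vel t₀ l t₀) with hE₀
  have hgap := gap_nonneg (A := A) hf hconv hβ xs
  have hE₀_nonneg : 0 ≤ E₀ := by
    have h1 := mul_nonneg (mul_nonneg (by positivity : 0 ≤ θ ^ 2 * t₀ ^ 2) (hδ_pos t₀ le_rfl).le)
      (hgap (x t₀))
    rw [hE₀, energy, ← hξ_def]
    positivity
  set R₁ := √(2 * E₀ / ξ) with hR₁
  set R₂ := √(2 * E₀) with hR₂
  set R₃ := √(E₀ / θ ^ 2) with hR₃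
  have h₁ : 0 ≤ R₁ := Real.sqrt_nonneg _
  have h₂ : 0 ≤ R₂ := Real.sqrt_nonneg _
  have h₃ : 0 ≤ R₃ := Real.sqrt_nonneg _
  refine ⟨R₁ + R₂ + R₃, by positivity, fun t ht => ?_⟩
  have hE := hsol.energy_le hf hconv hopt ht₀ hβ hθ hξ.le hδ hδ_pos hδ_le ht
  rw [← hE₀, energy, ← hξ_def] at hE
  have ht' := ht₀.trans_le ht
  have hδt := hδ_pos t ht
  have hg : 0 ≤ θ ^ 2 * t ^ 2 * δ t * gap f A β xs (x t) :=
    mul_nonneg (by positivity) (hgap _)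
  have hp := sq_nonneg ‖x t - xs + (θ * t) • vel t₀ x t‖
  have hn := sq_nonneg ‖l t - ls + (θ * t) • vel t₀ l t‖
  have hx := mul_nonneg hξ.le (sq_nonneg ‖x t - xs‖)
  have hl := mul_nonneg hξ.le (sq_nonneg ‖l t - ls‖)
  refine ⟨?_, ?_, ?_, ?_, ?_⟩
  · have : ‖x t - xs‖ ≤ R₁ := by
      apply Real.le_sqrt_of_sq_le
      rw [le_div_iff₀ hξ]; linarith
    linarith
  · have : ‖l t - ls‖ ≤ R₁ := by
      apply Real.le_sqrt_of_sq_le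
      rw [le_div_iff₀ hξ]; linarith
    linarith
  · have : ‖x t - xs + (θ * t) • vel t₀ x t‖ ≤ R₂ := by
      apply Real.le_sqrt_of_sq_le
      linarith
    linarith
  · have : ‖l t - ls + (θ * t) • vel t₀ l t‖ ≤ R₂ := by
      apply Real.le_sqrt_of_sq_le
      linarith
    linarith
  · have h5 : t ^ 2 * δ t * gap f A β xs (x t) ≤ R₃ ^ 2 := by
      rw [hR₃, Real.sq_sqrt (by positivity), le_div_iff₀ (by positivity)]
      linarith
    exact h5.trans (pow_le_pow_left₀ h₃ (by linarith) 2)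

/-- The function `t x' + (α - 1) (x - xs)` is an antiderivative of `t x'' + α x'`. -/
theorem hasDerivWithinAt_smul_vel_add {E : Type*} [NormedAddCommGroup E] [NormedSpace ℝ E]
    {t₀ : ℝ} {x : ℝ → E} (hx : ContDiffOn ℝ 2 x (Set.Ici t₀)) (α : ℝ) (xs : E) {t : ℝ}
    (ht : t₀ ≤ t) :
    HasDerivWithinAt (fun t => t • vel t₀ x t + (α - 1) • (x t - xs))
      (t • acc t₀ x t + α • vel t₀ x t) (Set.Ici t₀) t := by
  refine (((hasDerivWithinAt_id t (Set.Ici t₀)).fun_smul (hx.hasDerivWithinAt_acc ht)).fun_add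
    (((hx.hasDerivWithinAt_vel ht).sub_const xs).fun_const_smul (α - 1))).congr_deriv ?_
  simp only [id]
  module

theorem norm_smul_vel_add_le {E : Type*} [NormedAddCommGroup E] [NormedSpace ℝ E]
    {θ t α R : ℝ} {p v : E} (hθ : 0 < θ) (hp : ‖p‖ ≤ R) (hv : ‖p + (θ * t) • v‖ ≤ R) :
    ‖t • v + (α - 1) • p‖ ≤ θ⁻¹ * R + |α - 1 - θ⁻¹| * R := by
  have h : t • v + (α - 1) • p = θ⁻¹ • (p + (θ * t) • v) + (α - 1 - θ⁻¹) • p := by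
    rw [smul_add, smul_smul, ← mul_assoc, inv_mul_cancel₀ hθ.ne', one_mul]
    module
  rw [h]
  refine (norm_add_le _ _).trans (add_le_add ?_ ?_)
  · rw [norm_smul, Real.norm_of_nonneg (inv_nonneg.2 hθ.le)]
    gcongr
  · rw [norm_smul, Real.norm_eq_abs]
    gcongr

/-- Boundedness of the energy gives the rate of the gradient; the other two follow by applying
`exists_norm_le_of_hasDerivWithinAt` to the dual equation and then to the primal one. -/
theorem IsSolution.exists_rates (hsol : IsSolution f A b α β θ t₀ δ x₀ l₀ v₀ m₀ x l)
    (hf : Differentiable ℝ f) (hconv : ConvexOn ℝ Set.univ f)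
    {ℓ : ℝ≥0} (hℓ : 0 < ℓ) (hlip : LipschitzWith ℓ (gradient f))
    (hopt : IsPrimalDualSolution f A b xs ls)
    (ht₀ : 0 < t₀) (hβ : 0 ≤ β) (hθ : 0 < θ) (hξ : 0 < θ * (α - 1) - 1) {dδ : ℝ → ℝ}
    (hδ : ∀ t, t₀ ≤ t → HasDerivWithinAt δ (dδ t) (Set.Ici t₀) t)
    (hδ_pos : ∀ t, t₀ ≤ t → 0 < δ t) (hδ_mono : MonotoneOn δ (Set.Ici t₀))
    (hδ_le : ∀ t, t₀ ≤ t → θ * (2 * δ t + t * dδ t) ≤ δ t) :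
    ∃ K, ∀ t, t₀ ≤ t →
      ‖gradient f (x t) - gradient f xs‖ ≤ K / (t * √(δ t)) ∧
      ‖A.adjoint (l t - ls)‖ ≤ K / (t * √(δ t)) ∧
      ‖A (x t) - b‖ ≤ K / (t ^ 2 * δ t) := by
  obtain ⟨R, hR, hbd⟩ := hsol.exists_bound hf hconv hopt ht₀ hβ hθ hξ hδ hδ_pos hδ_le
  set M := θ⁻¹ * R + |α - 1 - θ⁻¹| * R with hM
  -- Since `δ` is nondecreasing, `1 / (t ^ 2 δ)` is dominated by `1 / (t √δ)`.
  set c := 1 / (t₀ * √(δ t₀)) with hc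
  have hc0 : 0 ≤ c := by positivity
  have hsq : ∀ K, 0 ≤ K → ∀ t, t₀ ≤ t → K / (t ^ 2 * δ t) ≤ K * c / (t * √(δ t)) := by
    intro K hK t ht
    have hs₀ := Real.sqrt_pos.2 (hδ_pos t₀ le_rfl)
    have ht' := ht₀.trans_le ht
    have hle : t₀ * √(δ t₀) ≤ t * √(δ t) := by
      have := Real.sqrt_le_sqrt (hδ_mono Set.self_mem_Ici ht ht)
      gcongr
    have hτ : 0 < t₀ * √(δ t₀) := mul_pos ht₀ hs₀
    have e : t ^ 2 * δ t = (t * √(δ t)) * (t * √(δ t)) := by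
      rw [mul_mul_mul_comm, Real.mul_self_sqrt (hδ_pos t ht).le]; ring
    rw [e, hc, ← div_div, mul_one_div]
    have hτt := hτ.trans_le hle
    rw [div_div, div_div]
    gcongr
  obtain ⟨K₁, hK₁, hy⟩ := exists_norm_le_of_hasDerivWithinAt ht₀ hθ le_rfl hδ hδ_pos hδ_le
    (u := fun t => A (x t - xs)) (r := fun _ => 0) (M := M)
    (fun t ht => A.hasFDerivAt.comp_hasDerivWithinAt t
      ((hsol.contDiffOn_x.hasDerivWithinAt_vel ht).sub_const xs))
    (fun t ht => hasDerivWithinAt_smul_vel_add hsol.contDiffOn_l α ls ht)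
    (fun t ht => by
      have := (ht₀.trans_le ht).ne'
      rw [hsol.acc_dual_eq hopt ht, map_add, map_smul, smul_add, smul_smul,
        show t * -(α / t) = -α by field_simp]
      module)
    (fun t ht => norm_smul_vel_add_le hθ (hbd t ht).2.1 (hbd t ht).2.2.2.1)
    (fun t ht => by simp)
  simp only [mul_zero, zero_div, add_zero] at hy
  set C₁ := 2 * √ℓ * R with hC₁
  have he : ∀ t, t₀ ≤ t → ‖gradient f (x t) - gradient f xs‖ ≤ C₁ / (t * √(δ t)) := by
    intro t ht
    have hδt := hδ_pos t ht
    have ht' := ht₀.trans_le ht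
    refine le_of_sq_le_sq ?_ (by positivity)
    refine (hconv.norm_sub_gradient_sq_le hf hℓ hlip (x t) xs).trans ?_
    have h1 : f (x t) - f xs - inner ℝ (gradient f xs) (x t - xs) ≤ gap f A β xs (x t) :=
      le_add_of_nonneg_right (by positivity)
    have h2 : gap f A β xs (x t) ≤ R ^ 2 / (t ^ 2 * δ t) := by
      rw [le_div_iff₀ (by positivity), mul_comm]
      exact (hbd t ht).2.2.2.2
    calc 4 * ℓ * (f (x t) - f xs - inner ℝ (gradient f xs) (x t - xs))
        ≤ 4 * ℓ * (R ^ 2 / (t ^ 2 * δ t)) :=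
          mul_le_mul_of_nonneg_left (h1.trans h2) (by positivity)
      _ = (C₁ / (t * √(δ t))) ^ 2 := by
          rw [hC₁, div_pow, mul_pow, mul_pow, mul_pow, Real.sq_sqrt ℓ.coe_nonneg,
            Real.sq_sqrt hδt.le]
          ring
  set C₂ := C₁ + β * ‖A.adjoint‖ * (K₁ * c) with hC₂
  have hC₁0 : 0 ≤ C₁ := by positivity
  obtain ⟨K₂, hK₂, hq⟩ := exists_norm_le_of_hasDerivWithinAt (C := C₂) ht₀ hθ (by positivity)
    hδ hδ_pos hδ_le (u := fun t => A.adjoint (l t - ls)) (M := M)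
    (r := fun t => -(gradient f (x t) - gradient f xs + β • A.adjoint (A (x t - xs))))
    (fun t ht => A.adjoint.hasFDerivAt.comp_hasDerivWithinAt t
      ((hsol.contDiffOn_l.hasDerivWithinAt_vel ht).sub_const ls))
    (fun t ht => (hasDerivWithinAt_smul_vel_add hsol.contDiffOn_x α xs ht).fun_neg)
    (fun t ht => by
      have := (ht₀.trans_le ht).ne'
      rw [hsol.acc_primal_eq hf hopt ht, map_add, map_smul, smul_sub, smul_smul,
        show t * -(α / t) = -α by field_simp]
      module)
    (fun t ht => by
      rw [norm_neg]
      exact norm_smul_vel_add_le hθ (hbd t ht).1 (hbd t ht).2.2.1)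
    (fun t ht => by
      rw [norm_neg]
      refine (norm_add_le _ _).trans ?_
      rw [hC₂, add_div]
      refine add_le_add (he t ht) ?_
      rw [norm_smul, Real.norm_of_nonneg hβ, mul_div_assoc, mul_assoc β]
      refine mul_le_mul_of_nonneg_left ((A.adjoint.le_opNorm _).trans ?_) hβ
      exact mul_le_mul_of_nonneg_left ((hy t ht).trans (hsq K₁ hK₁ t ht)) (norm_nonneg _))
  refine ⟨C₁ + (K₂ * c + 2 * C₂) + K₁, fun t ht => ?_⟩
  have hC₂0 : 0 ≤ C₂ := by positivity
  have hδt := hδ_pos t ht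
  have ht' := ht₀.trans_le ht
  have hn : 0 ≤ K₂ * c + 2 * C₂ := by positivity
  refine ⟨(he t ht).trans ?_, ?_, ?_⟩
  · gcongr
    linarith
  · have h := (hq t ht).trans (add_le_add_left (hsq K₂ hK₂ t ht) _)
    rw [← add_div] at h
    refine h.trans (div_le_div_of_nonneg_right ?_ (by positivity))
    linarith
  · have h := hy t ht
    rw [map_sub, hopt.map_eq] at h
    refine h.trans ?_
    gcongr
    linarith

end PrimalDual

/-! ### Asymptotic comparison -/

/-- A rate `O(1 / (t √δ))` improves on `o(1 / (√t δ ^ (1 / 4)))`, because `t √δ` is the square of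
`√t δ ^ (1 / 4)`, which tends to infinity. -/
theorem isLittleO_of_le_div_mul_sqrt {δ g : ℝ → ℝ} {t₀ K : ℝ} (ht₀ : 0 < t₀)
    (hδ_pos : ∀ t, t₀ ≤ t → 0 < δ t) (hδ_mono : MonotoneOn δ (Set.Ici t₀))
    (hg : ∀ t, t₀ ≤ t → ‖g t‖ ≤ K / (t * √(δ t))) :
    g =o[atTop] fun t => 1 / (√t * δ t ^ (1 / 4 : ℝ)) := by
  set σ : ℝ → ℝ := fun t => √t * δ t ^ (1 / 4 : ℝ) with hσ
  have hσ_tendsto : Tendsto σ atTop atTop := by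
    refine tendsto_atTop_mono' atTop ?_
      (Real.tendsto_sqrt_atTop.atTop_mul_const
        (Real.rpow_pos_of_pos (hδ_pos t₀ le_rfl) (1 / 4 : ℝ)))
    filter_upwards [eventually_ge_atTop t₀] with t ht
    have h1 := hδ_mono Set.self_mem_Ici ht ht
    have h2 := (hδ_pos t₀ le_rfl).le
    simp only [hσ]
    gcongr
  have hlim : Tendsto (fun t => 1 / σ t) atTop (nhds 0) := by
    exact hσ_tendsto.const_div_atTop 1
  have h1 : g =O[atTop] fun t => 1 / σ t * (1 / σ t) := by
    refine IsBigO.of_bound K ?_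
    filter_upwards [eventually_ge_atTop t₀] with t ht
    refine (hg t ht).trans_eq ?_
    have hδt := hδ_pos t ht
    have hsq : t * √(δ t) = σ t * σ t := by
      simp only [hσ]
      rw [mul_mul_mul_comm, Real.mul_self_sqrt (ht₀.trans_le ht).le, ← Real.rpow_add hδt,
        Real.sqrt_eq_rpow]
      norm_num
    rw [Real.norm_of_nonneg (mul_self_nonneg _), hsq, div_mul_div_comm, one_mul, mul_one_div]
  have h2 : (fun t => 1 / σ t * (1 / σ t)) =o[atTop] fun t => (1 : ℝ) * (1 / σ t) :=
    ((isLittleO_one_iff ℝ).2 hlim).mul_isBigO (isBigO_refl _ _)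
  simpa only [one_mul] using h1.trans_isLittleO h2

theorem mainTheorem3
    {X Y : Type*} [NormedAddCommGroup X] [InnerProductSpace ℝ X] [CompleteSpace X]
    [NormedAddCommGroup Y] [InnerProductSpace ℝ Y] [CompleteSpace Y]
    (f : X → ℝ) (hf_diff : ContDiff ℝ 1 f) (hf_conv : ConvexOn ℝ Set.univ f)
    (A : X →L[ℝ] Y) (b : Y)
    (ℓ : ℝ≥0) (hℓ : 0 < ℓ) (hf_lip : LipschitzWith ℓ (gradient f))
    (t₀ α β θ : ℝ) (ht₀ : 0 < t₀) (hα : 3 < α) (hβ : 0 ≤ β)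
    (hθ : 1 / (α - 1) < θ) (hθ' : θ < 1 / 2)
    (δ : ℝ → ℝ) (hδ_diff : ContDiffOn ℝ 1 δ (Set.Ici t₀))
    (hδ_pos : ∀ t, t₀ ≤ t → 0 < δ t) (hδ_mono : MonotoneOn δ (Set.Ici t₀))
    (hδ_bdd : BddAbove (Set.range fun t : Set.Ici t₀ =>
      (t : ℝ) * derivWithin δ (Set.Ici t₀) t / δ t))
    (hδ_sup : (⨆ t : Set.Ici t₀, (t : ℝ) * derivWithin δ (Set.Ici t₀) t / δ t)
      < (1 - 2 * θ) / θ)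
    (x₀ v₀ : X) (l₀ m₀ : Y) (x : ℝ → X) (l : ℝ → Y)
    (hsol : PrimalDual.IsSolution f A b α β θ t₀ δ x₀ l₀ v₀ m₀ x l)
    (xs : X) (ls : Y) (hopt : PrimalDual.IsPrimalDualSolution f A b xs ls) :
    ((fun t => ‖gradient f (x t) - gradient f xs‖)
      =o[atTop] fun t => 1 / (Real.sqrt t * δ t ^ (1 / 4 : ℝ))) ∧
    ((fun t => ‖ContinuousLinearMap.adjoint A (l t - ls)‖)
      =o[atTop] fun t => 1 / (Real.sqrt t * δ t ^ (1 / 4 : ℝ))) ∧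
    (∀ t, t₀ ≤ t →
      ‖gradient (fun z => PrimalDual.lagrangian f A b z (l t)) (x t)‖
        = ‖gradient f (x t) + ContinuousLinearMap.adjoint A (l t)‖) ∧
    ((fun t => ‖gradient (fun z => PrimalDual.lagrangian f A b z (l t)) (x t)‖)
      =o[atTop] fun t => 1 / (Real.sqrt t * δ t ^ (1 / 4 : ℝ))) ∧
    (∀ t, t₀ ≤ t →
      ‖gradient (fun m => PrimalDual.lagrangian f A b (x t) m) (l t)‖ = ‖A (x t) - b‖) ∧
    ((fun t => ‖A (x t) - b‖) =O[atTop] fun t => 1 / (t ^ 2 * δ t)) := by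
  have hθ0 : 0 < θ := (one_div_pos.2 (by linarith)).trans hθ
  have hξ : 0 < θ * (α - 1) - 1 := by
    rw [div_lt_iff₀ (by linarith)] at hθ
    linarith
  have hf : Differentiable ℝ f := hf_diff.differentiable one_ne_zero
  have hδ : ∀ t, t₀ ≤ t →
      HasDerivWithinAt δ (derivWithin δ (Set.Ici t₀) t) (Set.Ici t₀) t := fun t ht =>
    (hδ_diff.differentiableOn one_ne_zero t ht).hasDerivWithinAt
  have hδ_le : ∀ t, t₀ ≤ t → θ * (2 * δ t + t * derivWithin δ (Set.Ici t₀) t) ≤ δ t := by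
    intro t ht
    have h := (le_ciSup hδ_bdd ⟨t, ht⟩).trans hδ_sup.le
    rw [div_le_div_iff₀ (hδ_pos t ht) hθ0] at h
    linarith
  obtain ⟨K, hK⟩ := hsol.exists_rates hf hf_conv hℓ hf_lip hopt ht₀ hβ hθ0 hξ hδ hδ_pos
    hδ_mono hδ_le
  have hx : (fun t => ‖gradient f (x t) - gradient f xs‖)
      =o[atTop] fun t => 1 / (Real.sqrt t * δ t ^ (1 / 4 : ℝ)) :=
    isLittleO_of_le_div_mul_sqrt ht₀ hδ_pos hδ_mono fun t ht => by
      rw [norm_norm]; exact (hK t ht).1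
  have hl : (fun t => ‖ContinuousLinearMap.adjoint A (l t - ls)‖)
      =o[atTop] fun t => 1 / (Real.sqrt t * δ t ^ (1 / 4 : ℝ)) :=
    isLittleO_of_le_div_mul_sqrt ht₀ hδ_pos hδ_mono fun t ht => by
      rw [norm_norm]; exact (hK t ht).2.1
  refine ⟨hx, hl, fun t _ => ?_, ?_, fun t _ => ?_, ?_⟩
  · rw [PrimalDual.gradient_lagrangian_left A b _ (hf (x t))]
  · refine IsBigO.trans_isLittleO (IsBigO.of_bound 1 (Eventually.of_forall fun t => ?_))
      (hx.add hl)
    -- Stationarity of the saddle point splits the gradient into the two differences.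
    have hsplit : gradient f (x t) + A.adjoint (l t)
        = (gradient f (x t) - gradient f xs) + A.adjoint (l t - ls) := by
      rw [hopt.gradient_eq (hf xs), map_sub]
      abel
    rw [PrimalDual.gradient_lagrangian_left A b _ (hf (x t)), hsplit, norm_norm, one_mul,
      Real.norm_of_nonneg (by positivity)]
    exact norm_add_le _ _
  · rw [PrimalDual.gradient_lagrangian_right]
  · refine IsBigO.of_bound K ?_
    filter_upwards [eventually_ge_atTop t₀] with t ht
    have hδt := hδ_pos t ht
    rw [norm_norm, Real.norm_of_nonneg (by positivity), mul_one_div]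
    exact (hK t ht).2.2
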